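/- For $\gamma>0$ let $\mu=\mu(\gamma)$ and $\sigma=\sigma(\gamma)$ be real numbers with $(\mu,\sigma)\neq(0,0)$ for all $\gamma>0$, and assume that $\mu(\gamma)\to0$ and $\sigma(\gamma)\to0$ as $\gamma\to\infty$ (either function may vanish identically). Let $$q(x)=\frac1{\sqrt{2\pi}}e^{-x^2/2},\qquad q_\gamma(x)=\frac1{\sqrt{2\pi(1+\sigma^2)}}\,e^{-\frac{(x-\mu)^2}{2(1+\sigma^2)}},\qquad x\in\mathbb R .$$ For $p\in\{q,q_\gamma\}$ let $X,X_1,X_2,\dots$ be i.i.d. with density $p$ under $\mathbb P_p$, and put $Y=\log\frac{q_\gamma(X)}{q(X)}$, $Y_j=\log\frac{q_\gamma(X_j)}{q(X_j)}$ and $S_k=\sum_{j=1}^kY_j$. For $a\le0<b$ let $T=T_{a,b}=\inf\{k\ge1: S_k\notin(a,b)\}$; the events $\{S_T\ge b\}$ and $\{S_T\le a\}$ are understood to include $T<\infty$. A conditional expectation given an event of probability zero is taken to be $0$ (this occurs only in the second condition below, for $y$ at or below the essential infimum of $Y$). Then, for both choices $p=q$ and $p=q_\gamma$, the variable $Y$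 is integrable, $\mathbb P_p(Y\ge y)>0$ for all $y\ge0$, $\mathbb P_p(Y\le0)>0$, and $$\lim_{\gamma\to\infty}\ \sup_{y\ge0}\ \mathbb E_p[Y-y\mid Y\ge y]=0,\qquad \lim_{\gamma\to\infty}\ \inf_{y\le0}\ \mathbb E_p[Y-y\mid Y\le y]=0 .$$ Consequently the overshoots vanish asymptotically: for all fixed real $a\le0<b$ and for both choices of $p$, the events $\{S_T\ge b\}$ and $\{S_T\le a\}$ have positive probability for every $\gamma>0$, $S_T$ is integrable on each of them, and $$\lim_{\gamma\to\infty}\mathbb E_p[S_T-b\mid S_T\ge b]=0,\qquad \lim_{\gamma\to\infty}\mathbb E_p[S_T-a\mid S_T\le a]=0 .$$ -/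

import Mathlib

open MeasureTheory ProbabilityTheory Filter Topology
open scoped NNReal ENNReal

noncomputable section

namespace GaussianOvershoot

/-- The log-likelihood ratio `log (q₁ x / q₀ x)` of the density `q₁` with respect to `q₀`. -/
def logLR (q₀ q₁ : ℝ → ℝ) (x : ℝ) : ℝ := Real.log (q₁ x / q₀ x)

/-- The elementary conditional expectation `E_P[U | A]` given an event `A`.
It is `0` if `P A = 0`. -/
def condMean {Ω : Type*} [MeasurableSpace Ω] (P : Measure Ω) (U : Ω → ℝ) (A : Set Ω) : ℝ :=
  ∫ ω, U ω ∂(ProbabilityTheory.cond P A)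

/-! In what follows `P γ` is the law of one observation `X` and `Y γ x` is the value of the
log-likelihood ratio at the observation `x`, for the parameter `γ > 0`. -/

/-- `lim_γ sup_{y ≥ 0} E[Y - y | Y ≥ y] = 0`. The supremum is taken in the extended reals.
The conditional expectations make sense: `Y` is integrable and `{Y ≥ y}` has positive
probability for every `y ≥ 0`. -/
def UpperCondition (P : ℝ → Measure ℝ) (Y : ℝ → ℝ → ℝ) : Prop :=
  (∀ γ, 0 < γ → Integrable (Y γ) (P γ) ∧ ∀ y, 0 ≤ y → P γ {x | y ≤ Y γ x} ≠ 0) ∧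
  Tendsto (fun γ : ℝ => ⨆ (y : ℝ) (_ : 0 ≤ y),
      ((condMean (P γ) (fun x => Y γ x - y) {x | y ≤ Y γ x} : ℝ) : EReal)) atTop (𝓝 0)

/-- `lim_γ inf_{y ≤ 0} E[Y - y | Y ≤ y] = 0`. The infimum is taken in the extended reals.
If `Y` is bounded below, then `{Y ≤ y}` is a null event for very negative `y`; the conditional
expectation given such an event is `0` by convention. -/
def LowerCondition (P : ℝ → Measure ℝ) (Y : ℝ → ℝ → ℝ) : Prop :=
  (∀ γ, 0 < γ → Integrable (Y γ) (P γ) ∧ P γ {x | Y γ x ≤ 0} ≠ 0) ∧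
  Tendsto (fun γ : ℝ => ⨅ (y : ℝ) (_ : y ≤ 0),
      ((condMean (P γ) (fun x => Y γ x - y) {x | Y γ x ≤ y} : ℝ) : EReal)) atTop (𝓝 0)

/-- The law of an i.i.d. sequence `X₁, X₂, …` (coordinates `ω 0, ω 1, …`) with marginal `P`. -/
def iidLaw (P : Measure ℝ) : Measure (ℕ → ℝ) := Measure.infinitePi fun _ => P

/-- The random walk `S_k = ∑_{j=1}^k Y(X_j)`. -/
def walk (Y : ℝ → ℝ) (k : ℕ) (ω : ℕ → ℝ) : ℝ := ∑ j ∈ Finset.range k, Y (ω j)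

/-- The stopping time `T_{a,b} = inf {k ≥ 1 : S_k ∉ (a, b)}`, equal to `⊤` if there is no
such `k`. -/
def exitTime (Y : ℝ → ℝ) (a b : ℝ) : (ℕ → ℝ) → WithTop ℕ :=
  hittingAfter (walk Y) (Set.Ioo a b)ᶜ 1

/-- The value `S_T` at `T = T_{a,b}` (used on `{T < ∞}` only). -/
def exitValue (Y : ℝ → ℝ) (a b : ℝ) : (ℕ → ℝ) → ℝ :=
  stoppedValue (walk Y) (exitTime Y a b)

/-- The event `{T < ∞, S_T ≥ b}`. -/
def exitAbove (Y : ℝ → ℝ) (a b : ℝ) : Set (ℕ → ℝ) :=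
  {ω | exitTime Y a b ω ≠ ⊤ ∧ b ≤ exitValue Y a b ω}

/-- The event `{T < ∞, S_T ≤ a}`. -/
def exitBelow (Y : ℝ → ℝ) (a b : ℝ) : Set (ℕ → ℝ) :=
  {ω | exitTime Y a b ω ≠ ⊤ ∧ exitValue Y a b ω ≤ a}

/-- `lim_γ E[S_T - b | S_T ≥ b] = 0`, where all these conditional expectations make sense. -/
def UpperOvershootVanishes (P : ℝ → Measure ℝ) (Y : ℝ → ℝ → ℝ) (a b : ℝ) : Prop :=
  (∀ γ, 0 < γ → iidLaw (P γ) (exitAbove (Y γ) a b) ≠ 0 ∧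
    IntegrableOn (exitValue (Y γ) a b) (exitAbove (Y γ) a b) (iidLaw (P γ))) ∧
  Tendsto (fun γ : ℝ => condMean (iidLaw (P γ))
    (fun ω => exitValue (Y γ) a b ω - b) (exitAbove (Y γ) a b)) atTop (𝓝 0)

/-- `lim_γ E[S_T - a | S_T ≤ a] = 0`, where all these conditional expectations make sense. -/
def LowerOvershootVanishes (P : ℝ → Measure ℝ) (Y : ℝ → ℝ → ℝ) (a b : ℝ) : Prop :=
  (∀ γ, 0 < γ → iidLaw (P γ) (exitBelow (Y γ) a b) ≠ 0 ∧
    IntegrableOn (exitValue (Y γ) a b) (exitBelow (Y γ) a b) (iidLaw (P γ))) ∧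
  Tendsto (fun γ : ℝ => condMean (iidLaw (P γ))
    (fun ω => exitValue (Y γ) a b ω - a) (exitBelow (Y γ) a b)) atTop (𝓝 0)

/-- The post-change variance `1 + s ^ 2`. -/
def postVar (s : ℝ) : ℝ≥0 := ⟨1 + s ^ 2, by positivity⟩

/-- The log-likelihood ratio of the `N(m, 1 + s ^ 2)` density with respect to the `N(0, 1)`
density. -/
def gaussianLogLR (m s : ℝ) : ℝ → ℝ :=
  logLR (gaussianPDFReal 0 1) (gaussianPDFReal m (postVar s))

end GaussianOvershoot

end

namespace GaussianOvershoot

/-! Under either density, `Y` has the law of a quadratic `α x² + β x + κ` of a standard Gaussian,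
with `α ≥ 0` and all coefficients tending to `0` as `γ → ∞`. It therefore suffices to bound the mean
excess and the mean shortfall of such a quadratic, uniformly in the level, by a multiple of `α + |β|
+ |κ|` (`overshootBound_quadratic`).

The uniformity comes from Stein's identity: on an interval `D ⊆ [0, ∞)` with left endpoint `r`, the
conditional mean of `x (x - r)` is at most `1`, wherever `r` lies. On each half-line the relevant
level sets are intervals on which the excess is at most `c₁ + c₂ x (x - r)`. The exception is an
upper level at most `κ`; there the level set has mass at least `1/2` and a crude moment bound
suffices.

The bound passes to the walk by conditioning on the state `u` just before exit
(`lintegral_exit_le`): exiting above `b` means that one step exceeds the level `b - u ≥ 0`, and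
exiting below means that it falls under `a - u ≤ 0`. Every term of the sum over exit times obeys the
one-step bound, hence so does the overshoot. -/

/-! ### Stein's inequality on intervals -/

lemma hasDerivAt_stdGaussianPDF (x : ℝ) :
    HasDerivAt (gaussianPDFReal 0 1) (-x * gaussianPDFReal 0 1 x) x := by
  have h : gaussianPDFReal 0 1 = fun x => (√(2 * Real.pi))⁻¹ * Real.exp (-x ^ 2 / 2) := by
    ext x; simp [gaussianPDFReal]
  rw [h]
  have h1 : HasDerivAt (fun x : ℝ => -x ^ 2 / 2) (-x) x := by
    refine (((hasDerivAt_pow 2 x).neg).div_const 2).congr_deriv ?_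
    norm_num
    ring
  exact ((h1.exp).const_mul (√(2 * Real.pi))⁻¹).congr_deriv (by ring)

lemma setIntegral_stdGaussian {D : Set ℝ} (hD : MeasurableSet D) (f : ℝ → ℝ) :
    ∫ x in D, f x ∂(gaussianReal 0 1) = ∫ x in D, gaussianPDFReal 0 1 x * f x := by
  rw [← integral_indicator hD, integral_gaussianReal_eq_integral_smul one_ne_zero,
    ← integral_indicator hD]
  congr 1; ext x
  by_cases hx : x ∈ D <;> simp [hx]

lemma integrable_pow_stdGaussian (n : ℕ) :
    Integrable (fun x : ℝ => x ^ n) (gaussianReal 0 1) :=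
  (memLp_id_gaussianReal (μ := 0) (v := 1) n).integrable_norm_pow' |>.mono'
    (by fun_prop) (by simp)

lemma integrable_quadratic_stdGaussian (α β κ : ℝ) :
    Integrable (fun x : ℝ => α * x ^ 2 + β * x + κ) (gaussianReal 0 1) :=
  (((integrable_pow_stdGaussian 2).const_mul α).add
    ((by simpa using (integrable_pow_stdGaussian 1).const_mul β))).add (integrable_const κ)

/-- The antiderivative behind Stein's identity for `x ↦ (x - r)⁺`. -/
lemma hasDerivAt_stein (r x : ℝ) :
    HasDerivAt (fun x => -((x - r) * gaussianPDFReal 0 1 x))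
      (gaussianPDFReal 0 1 x * (x * (x - r) - 1)) x := by
  refine (((hasDerivAt_id x).sub_const r).mul (hasDerivAt_stdGaussianPDF x)).neg.congr_deriv ?_
  simp only [id_eq]; ring

lemma continuous_stdGaussianPDF : Continuous (gaussianPDFReal 0 1) :=
  continuous_iff_continuousAt.2 fun x => (hasDerivAt_stdGaussianPDF x).continuousAt

/-- The antiderivative `-(x - r) φ(x)` vanishes at `r` and is nonpositive at `R`. Equivalently, `x
(x - r)` has conditional mean at most `1` on the interval. -/
lemma stein_Icc {r R : ℝ} (h : r ≤ R) :
    ∫ x in Set.Icc r R, (x * (x - r) - 1) ∂(gaussianReal 0 1) ≤ 0 := by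
  rw [setIntegral_stdGaussian measurableSet_Icc, integral_Icc_eq_integral_Ioc,
    ← intervalIntegral.integral_of_le h,
    intervalIntegral.integral_eq_sub_of_hasDerivAt (fun x _ => hasDerivAt_stein r x)
      (Continuous.intervalIntegrable (by have := continuous_stdGaussianPDF; fun_prop) _ _)]
  have := mul_nonneg (sub_nonneg.2 h) (gaussianPDFReal_nonneg 0 1 R)
  simp [this]

lemma stein_Ici (r : ℝ) :
    ∫ x in Set.Ici r, (x * (x - r) - 1) ∂(gaussianReal 0 1) ≤ 0 := by
  refine le_of_tendsto (f := fun R : ℝ =>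
    ∫ x in Set.Icc r R, (x * (x - r) - 1) ∂(gaussianReal 0 1)) (x := atTop) ?_
    ((eventually_ge_atTop r).mono fun R hR => stein_Icc hR)
  have hi : Integrable (fun x : ℝ => x * (x - r) - 1) (gaussianReal 0 1) := by
    convert integrable_quadratic_stdGaussian 1 (-r) (-1) using 2
    ring
  simp_rw [← integral_indicator measurableSet_Icc, ← integral_indicator measurableSet_Ici]
  refine tendsto_integral_filter_of_dominated_convergence (fun x => |x * (x - r) - 1|)
    (Eventually.of_forall fun R => ?_) (Eventually.of_forall fun R => ?_) hi.abs ?_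
  · exact (hi.indicator measurableSet_Icc).aestronglyMeasurable
  · exact Eventually.of_forall fun x => norm_indicator_le_norm_self _ _
  · refine Eventually.of_forall fun x => tendsto_const_nhds.congr' ?_
    filter_upwards [eventually_ge_atTop x] with R hR
    simp [Set.indicator, hR]

lemma stein_ordConnected {D : Set ℝ} (hc : IsClosed D) (ho : D.OrdConnected)
    (hne : D.Nonempty) (hb : BddBelow D) :
    ∫ x in D, (x * (x - sInf D) - 1) ∂(gaussianReal 0 1) ≤ 0 := by
  have hm := hc.csInf_mem hne hb
  by_cases hB : BddAbove D
  · have : D = Set.Icc (sInf D) (sSup D) :=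
      Set.Subset.antisymm (fun x hx => ⟨csInf_le hb hx, le_csSup hB hx⟩)
        (ho.out hm (hc.csSup_mem hne hB))
    have h := stein_Icc (csInf_le_csSup hne hb hB)
    rwa [← this] at h
  · have : D = Set.Ici (sInf D) := by
      refine Set.Subset.antisymm (fun x hx => csInf_le hb hx) fun x hx => ?_
      obtain ⟨z, hz, hxz⟩ := not_bddAbove_iff.1 hB x
      exact ho.out hm hz ⟨hx, hxz.le⟩
    have h := stein_Ici (sInf D)
    rwa [← this] at h

/-- On a closed interval `D` of the half-line, a function with a bound
`c₁ + c₂ x (x - inf D)` has conditional standard Gaussian mean at most `c₁ + c₂`. -/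
lemma lintegral_le_of_le_stein {D : Set ℝ} (hc : IsClosed D) (ho : D.OrdConnected)
    (h0 : D ⊆ Set.Ici 0) {c₁ c₂ : ℝ} (h₁ : 0 ≤ c₁) (h₂ : 0 ≤ c₂) {h : ℝ → ℝ}
    (hh : ∀ x ∈ D, h x ≤ c₁ + c₂ * (x * (x - sInf D))) :
    ∫⁻ x in D, ENNReal.ofReal (h x) ∂(gaussianReal 0 1)
      ≤ ENNReal.ofReal (c₁ + c₂) * gaussianReal 0 1 D := by
  rcases D.eq_empty_or_nonempty with rfl | hne
  · simp
  have hb : BddBelow D := ⟨0, fun x hx => h0 hx⟩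
  have hs := stein_ordConnected hc ho hne hb
  set r := sInf D
  have hi : Integrable (fun x : ℝ => x * (x - r) - 1) (gaussianReal 0 1) := by
    convert integrable_quadratic_stdGaussian 1 (-r) (-1) using 2
    ring
  have hi2 : Integrable (fun x : ℝ => (c₁ + c₂) + c₂ * (x * (x - r) - 1)) (gaussianReal 0 1) :=
    (integrable_const _).add (hi.const_mul _)
  calc ∫⁻ x in D, ENNReal.ofReal (h x) ∂(gaussianReal 0 1)
      ≤ ∫⁻ x in D, ENNReal.ofReal ((c₁ + c₂) + c₂ * (x * (x - r) - 1)) ∂(gaussianReal 0 1) :=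
        setLIntegral_mono' hc.measurableSet fun x hx =>
          ENNReal.ofReal_le_ofReal ((hh x hx).trans (by linarith))
    _ = ENNReal.ofReal (∫ x in D, ((c₁ + c₂) + c₂ * (x * (x - r) - 1)) ∂(gaussianReal 0 1)) := by
        rw [ofReal_integral_eq_lintegral_ofReal hi2.integrableOn]
        refine (ae_restrict_iff' hc.measurableSet).2 (Eventually.of_forall fun x hx => ?_)
        have : 0 ≤ x * (x - r) := mul_nonneg (h0 hx) (sub_nonneg.2 (csInf_le hb hx))
        have := mul_nonneg h₂ this
        simp only [Pi.zero_apply]; linarith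
    _ ≤ ENNReal.ofReal ((c₁ + c₂) * (gaussianReal 0 1).real D) := by
        refine ENNReal.ofReal_le_ofReal ?_
        rw [integral_add (integrable_const _) (hi.const_mul _).integrableOn, integral_const_mul,
          setIntegral_const, smul_eq_mul]
        have := mul_nonpos_of_nonneg_of_nonpos h₂ hs
        linarith
    _ = _ := by
        rw [ENNReal.ofReal_mul (by positivity), ofReal_measureReal]

/-! ### Overshoots of quadratics of a Gaussian variable -/

/-- Uniform bound for the mean excess of `Y` over nonnegative levels and the mean shortfall of `Y`
below nonpositive levels. -/
def OvershootBound {Ω : Type*} [MeasurableSpace Ω] (P : Measure Ω) (Y : Ω → ℝ) (ε : ℝ) : Prop :=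
  (∀ y, 0 ≤ y → ∫⁻ x in {x | y ≤ Y x}, ENNReal.ofReal (Y x - y) ∂P
    ≤ ENNReal.ofReal ε * P {x | y ≤ Y x}) ∧
  (∀ y, y ≤ 0 → ∫⁻ x in {x | Y x ≤ y}, ENNReal.ofReal (y - Y x) ∂P
    ≤ ENNReal.ofReal ε * P {x | Y x ≤ y})

variable {α β κ y : ℝ}

lemma upper_half_bound (hα : 0 ≤ α) (hκ : κ < y) :
    ∫⁻ x in {x | 0 ≤ x ∧ y ≤ α * x ^ 2 + β * x + κ},
        ENNReal.ofReal (α * x ^ 2 + β * x + κ - y) ∂(gaussianReal 0 1)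
      ≤ ENNReal.ofReal (2 * (α + |β| + |κ|)) *
        gaussianReal 0 1 {x | 0 ≤ x ∧ y ≤ α * x ^ 2 + β * x + κ} := by
  set D := {x : ℝ | 0 ≤ x ∧ y ≤ α * x ^ 2 + β * x + κ} with hD
  have hc : IsClosed D := by
    have h := (isClosed_Ici (a := (0 : ℝ))).inter (isClosed_le (β := ℝ) (f := fun _ => y)
      (g := fun x => α * x ^ 2 + β * x + κ) continuous_const (by fun_prop))
    exact h
  have h0 : D ⊆ Set.Ici 0 := fun x hx => hx.1
  have hup : ∀ x ∈ D, ∀ z, x ≤ z → z ∈ D := by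
    rintro x ⟨hx0, hx⟩ z hz
    have hxp : 0 < x := by
      rcases hx0.lt_or_eq with h | h
      · exact h
      · subst h; norm_num at hx; linarith
    -- Since `κ < y`, the increment `x (α x + β)` from `0` to `x` is positive; by convexity the
    -- quadratic increases from `x` on.
    have h1 : 0 < α * x + β := by
      by_contra! h
      nlinarith [mul_nonpos_of_nonneg_of_nonpos hx0 h]
    refine ⟨hx0.trans hz, ?_⟩
    have : 0 ≤ (z - x) * (α * (z + x) + β) :=
      mul_nonneg (sub_nonneg.2 hz) (by nlinarith [mul_nonneg hα (hx0.trans hz)])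
    nlinarith
  have ho : D.OrdConnected := ⟨fun x hx z _ w hw => hup x hx w hw.1⟩
  have hb : BddBelow D := ⟨0, fun x hx => h0 hx⟩
  -- The constants come from `x² - r² ≤ 2 x (x - r)` and `x - r ≤ (1 + (x - r)²) / 2 ≤ (1 + x (x -
  -- r)) / 2`.
  refine (lintegral_le_of_le_stein hc ho h0 (c₁ := |β| / 2) (c₂ := 2 * α + |β| / 2)
    (by positivity) (by positivity) fun x hx => ?_).trans
    (mul_le_mul_left (ENNReal.ofReal_le_ofReal
      (by linarith [abs_nonneg β, abs_nonneg κ])) _)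
  obtain ⟨r0, hr⟩ := hc.csInf_mem ⟨x, hx⟩ hb
  have hrx := csInf_le hb hx
  set r := sInf D with hrdef
  -- The value at `0` is below `y`, so the level is attained in `[0, r]`, and minimality of `r` puts
  -- it at `r`.
  have hgr : α * r ^ 2 + β * r + κ = y := by
    obtain ⟨z, hz, hgz⟩ := intermediate_value_Icc r0
      (Continuous.continuousOn (f := fun x => α * x ^ 2 + β * x + κ) (by fun_prop))
      (show y ∈ Set.Icc _ _ from ⟨by simpa using hκ.le, hr⟩)
    have : r ≤ z := csInf_le hb ⟨hz.1, hgz.ge⟩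
    rw [le_antisymm this hz.2]; exact hgz
  have e : α * x ^ 2 + β * x + κ - y = (x - r) * (α * (x + r)) + β * (x - r) := by
    rw [← hgr]; ring
  have h1 : (x - r) * (α * (x + r)) ≤ 2 * α * (x * (x - r)) := by
    nlinarith [mul_nonneg hα (mul_nonneg (sub_nonneg.2 hrx) (sub_nonneg.2 hrx))]
  have h2 : β * (x - r) ≤ |β| * (x - r) :=
    mul_le_mul_of_nonneg_right (le_abs_self β) (sub_nonneg.2 hrx)
  have h3 : x - r ≤ (1 + x * (x - r)) / 2 := by
    nlinarith [mul_nonneg r0 (sub_nonneg.2 hrx), sq_nonneg (x - r - 1)]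
  have h4 := mul_le_mul_of_nonneg_left h3 (abs_nonneg β)
  rw [e]; linarith

lemma lower_half_bound (hα : 0 ≤ α) (hy : y ≤ 0) :
    ∫⁻ x in {x | 0 ≤ x ∧ α * x ^ 2 + β * x + κ ≤ y},
        ENNReal.ofReal (y - (α * x ^ 2 + β * x + κ)) ∂(gaussianReal 0 1)
      ≤ ENNReal.ofReal (2 * (α + |β| + |κ|)) *
        gaussianReal 0 1 {x | 0 ≤ x ∧ α * x ^ 2 + β * x + κ ≤ y} := by
  set D := {x : ℝ | 0 ≤ x ∧ α * x ^ 2 + β * x + κ ≤ y} with hD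
  have hc : IsClosed D := by
    have h := (isClosed_Ici (a := (0 : ℝ))).inter (isClosed_le (β := ℝ) (g := fun _ => y)
      (f := fun x => α * x ^ 2 + β * x + κ) (by fun_prop) continuous_const)
    exact h
  have h0 : D ⊆ Set.Ici 0 := fun x hx => hx.1
  have ho : D.OrdConnected := by
    refine ⟨fun x hx z hz w hw => ⟨hx.1.trans hw.1, ?_⟩⟩
    by_contra! h
    have h1 := mul_nonneg (sub_nonneg.2 hw.1) (sub_nonneg.2 hw.2)
    have hx2 := hx.2
    have hz2 := hz.2
    rcases hw.1.eq_or_lt with rfl | hxw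
    · linarith
    rcases hw.2.eq_or_lt with rfl | hwz
    · linarith
    -- Sublevel sets of a convex function are convex: the chord slope from `x` to `w` is positive,
    -- so the one from `w` to `z` is too.
    have h3 : 0 < α * (w + x) + β := by
      by_contra! h3
      nlinarith [mul_nonpos_of_nonneg_of_nonpos (sub_nonneg.2 hw.1) h3]
    have h4 : 0 < α * (z + w) + β := by nlinarith
    nlinarith [mul_pos (sub_pos.2 hwz) h4]
  have hb : BddBelow D := ⟨0, fun x hx => h0 hx⟩
  refine (lintegral_le_of_le_stein hc ho h0 (c₁ := |κ| + |β| / 2) (c₂ := |β| / 2)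
    (by positivity) (by positivity) fun x hx => ?_).trans
    (mul_le_mul_left (ENNReal.ofReal_le_ofReal
      (by linarith [abs_nonneg β, abs_nonneg κ])) _)
  obtain ⟨r0, hr⟩ := hc.csInf_mem ⟨x, hx⟩ hb
  have hrx := csInf_le hb hx
  set r := sInf D with hrdef
  -- Either `0 ∈ D`, so `r = 0` and `y ≤ 0 ≤ κ + |κ|`, or the quadratic equals `y` at `r` and the
  -- left side is `κ`.
  have hgr : y - (α * r ^ 2 + β * r) ≤ κ + |κ| := by
    by_cases hκ : κ ≤ y
    · have : r = 0 := le_antisymm (csInf_le hb ⟨le_rfl, by simpa using hκ⟩) r0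
      rw [this]; linarith [neg_abs_le κ]
    · obtain ⟨z, hz, hgz⟩ := intermediate_value_Icc' r0
        (Continuous.continuousOn (f := fun x => α * x ^ 2 + β * x + κ) (by fun_prop))
        (show y ∈ Set.Icc _ _ from ⟨hr, by simpa using (not_le.1 hκ).le⟩)
      have : r ≤ z := csInf_le hb ⟨hz.1, hgz.le⟩
      rw [le_antisymm hz.2 this] at hgz
      simp only at hgz
      linarith [abs_nonneg κ]
  have h1 : 0 ≤ (x - r) * (α * (x + r)) :=
    mul_nonneg (sub_nonneg.2 hrx) (mul_nonneg hα (add_nonneg hx.1 r0))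
  have h2 : -β * (x - r) ≤ |β| * (x - r) :=
    mul_le_mul_of_nonneg_right (neg_le_abs β) (sub_nonneg.2 hrx)
  have h3 : x - r ≤ (1 + x * (x - r)) / 2 := by
    nlinarith [mul_nonneg r0 (sub_nonneg.2 hrx), sq_nonneg (x - r - 1)]
  have h4 := mul_le_mul_of_nonneg_left h3 (abs_nonneg β)
  nlinarith

lemma measurePreserving_neg_stdGaussian :
    MeasurePreserving (fun x : ℝ => -x) (gaussianReal 0 1) (gaussianReal 0 1) :=
  ⟨measurable_neg, by simpa using gaussianReal_map_neg (μ := 0) (v := 1)⟩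

/-- A superlevel set of a convex quadratic need not be an interval, so the half-lines are treated
separately. Reflection preserves the Gaussian law and replaces `β` by `-β`; the halves overlap only
in the null set `{0}`. -/
lemma lintegral_le_of_halves {A : Set ℝ} (hA : MeasurableSet A) {F : ℝ → ℝ≥0∞} {c : ℝ≥0∞}
    (h₁ : ∫⁻ x in {x | 0 ≤ x ∧ x ∈ A}, F x ∂(gaussianReal 0 1)
      ≤ c * gaussianReal 0 1 {x | 0 ≤ x ∧ x ∈ A})
    (h₂ : ∫⁻ x in {x | 0 ≤ x ∧ -x ∈ A}, F (-x) ∂(gaussianReal 0 1)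
      ≤ c * gaussianReal 0 1 {x | 0 ≤ x ∧ -x ∈ A}) :
    ∫⁻ x in A, F x ∂(gaussianReal 0 1) ≤ c * gaussianReal 0 1 A := by
  set D₁ := {x : ℝ | 0 ≤ x ∧ x ∈ A}
  set D₂ := {x : ℝ | x ≤ 0 ∧ x ∈ A}
  have m₂ : MeasurableSet D₂ := measurableSet_Iic.inter hA
  have e : {x : ℝ | 0 ≤ x ∧ -x ∈ A} = (fun x : ℝ => -x) ⁻¹' D₂ := by
    ext x; simp [D₂]
  have hemb : MeasurableEmbedding (fun x : ℝ => -x) := (Homeomorph.neg ℝ).measurableEmbedding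
  rw [e, measurePreserving_neg_stdGaussian.setLIntegral_comp_preimage_emb hemb,
    measurePreserving_neg_stdGaussian.measure_preimage m₂.nullMeasurableSet] at h₂
  have hU : A = D₁ ∪ D₂ := by
    ext x; simp only [D₁, D₂, Set.mem_union, Set.mem_ofPred_eq]
    rcases le_total 0 x with h | h <;> tauto
  have hdisj : AEDisjoint (gaussianReal 0 1) D₁ D₂ := by
    have := nullSingletonClass_gaussianReal (μ := 0) (v := 1) one_ne_zero
    refine measure_mono_null (t := {0}) (fun x hx => ?_) (measure_singleton 0)
    exact le_antisymm hx.2.1 hx.1.1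
  calc ∫⁻ x in A, F x ∂(gaussianReal 0 1)
      ≤ ∫⁻ x in D₁, F x ∂(gaussianReal 0 1) + ∫⁻ x in D₂, F x ∂(gaussianReal 0 1) := by
        rw [hU]; exact lintegral_union_le _ _ _
    _ ≤ c * gaussianReal 0 1 D₁ + c * gaussianReal 0 1 D₂ := add_le_add h₁ h₂
    _ = c * gaussianReal 0 1 A := by
        rw [← mul_add, ← measure_union₀ m₂.nullMeasurableSet hdisj, ← hU]

lemma stdGaussian_half_le : 1 ≤ 2 * gaussianReal 0 1 (Set.Ici 0) := by
  have h := measurePreserving_neg_stdGaussian.measure_preimage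
    (measurableSet_Ici (a := (0 : ℝ))).nullMeasurableSet
  have e : Set.univ = Set.Ici (0 : ℝ) ∪ (fun x : ℝ => -x) ⁻¹' Set.Ici 0 := by
    ext x; simp
  rw [← measure_univ (μ := gaussianReal 0 1), e, two_mul]
  exact (measure_union_le _ _).trans (by rw [h])

lemma integral_sq_stdGaussian : ∫ x, x ^ 2 ∂(gaussianReal 0 1) = 1 := by
  have h := variance_fun_id_gaussianReal (μ := 0) (v := 1)
  rw [variance_of_integral_eq_zero (by fun_prop) (by simp)] at h
  simpa using h

/-- Here a half-line may meet the level set in two intervals, which rules out the Stein argument.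
But the level set contains the half-line where `β x ≥ 0`, of mass at least `1/2`; this is the source
of the factor `2`. -/
lemma upper_whole_bound (hα : 0 ≤ α) (hy : 0 ≤ y) (hκ : y ≤ κ) :
    ∫⁻ x in {x | y ≤ α * x ^ 2 + β * x + κ},
        ENNReal.ofReal (α * x ^ 2 + β * x + κ - y) ∂(gaussianReal 0 1)
      ≤ ENNReal.ofReal (2 * (α + |β| + |κ|)) *
        gaussianReal 0 1 {x | y ≤ α * x ^ 2 + β * x + κ} := by
  set A := {x : ℝ | y ≤ α * x ^ 2 + β * x + κ}
  have hA : 1 ≤ 2 * gaussianReal 0 1 A := by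
    rcases le_total 0 β with hβ | hβ
    · refine stdGaussian_half_le.trans (mul_le_mul_right (measure_mono fun x hx => ?_) _)
      have hx : (0 : ℝ) ≤ x := hx
      have : 0 ≤ α * x ^ 2 + β * x := by positivity
      exact show y ≤ _ by linarith
    · have h := measurePreserving_neg_stdGaussian.measure_preimage
        (measurableSet_Ici (a := (0 : ℝ))).nullMeasurableSet
      refine stdGaussian_half_le.trans (mul_le_mul_right ?_ _)
      rw [← h]
      refine measure_mono fun x hx => ?_
      have hx : 0 ≤ -x := hx
      have : 0 ≤ α * x ^ 2 + β * x := by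
        nlinarith [mul_nonneg hα (sq_nonneg x)]
      exact show y ≤ _ by linarith
  have hi : Integrable (fun x : ℝ => (α + |β| / 2) * x ^ 2 + 0 * x + (|β| / 2 + |κ|))
      (gaussianReal 0 1) := integrable_quadratic_stdGaussian _ _ _
  calc ∫⁻ x in A, ENNReal.ofReal (α * x ^ 2 + β * x + κ - y) ∂(gaussianReal 0 1)
      ≤ ∫⁻ x, ENNReal.ofReal (α * x ^ 2 + β * x + κ - y) ∂(gaussianReal 0 1) :=
        setLIntegral_le_lintegral _ _
    _ ≤ ∫⁻ x, ENNReal.ofReal ((α + |β| / 2) * x ^ 2 + 0 * x + (|β| / 2 + |κ|))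
          ∂(gaussianReal 0 1) := by
        refine lintegral_mono fun x => ENNReal.ofReal_le_ofReal ?_
        have h1 : β * x ≤ |β| * |x| := by rw [← abs_mul]; exact le_abs_self _
        have h2 : |x| ≤ (1 + x ^ 2) / 2 := by nlinarith [sq_nonneg (|x| - 1), sq_abs x]
        have h3 := mul_le_mul_of_nonneg_left h2 (abs_nonneg β)
        linarith [le_abs_self κ]
    _ = ENNReal.ofReal (α + |β| + |κ|) := by
        rw [← ofReal_integral_eq_lintegral_ofReal hi
          (Eventually.of_forall fun x => by
            simp only [Pi.zero_apply, zero_mul, add_zero]; positivity)]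
        congr 1
        simp only [zero_mul, add_zero]
        rw [integral_add ((integrable_pow_stdGaussian 2).const_mul _) (integrable_const _),
          integral_const_mul, integral_sq_stdGaussian]
        simp; ring
    _ ≤ ENNReal.ofReal (α + |β| + |κ|) * (2 * gaussianReal 0 1 A) := le_mul_of_one_le_right' hA
    _ = _ := by
        rw [ENNReal.ofReal_mul (by norm_num), ENNReal.ofReal_ofNat]; ring

/-- Quadratic polynomials of a standard Gaussian variable have small overshoots. -/
theorem overshootBound_quadratic (hα : 0 ≤ α) :
    OvershootBound (gaussianReal 0 1) (fun x => α * x ^ 2 + β * x + κ)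
      (2 * (α + |β| + |κ|)) := by
  refine ⟨fun y hy => ?_, fun y hy => ?_⟩
  · rcases lt_or_ge κ y with h | h
    · refine lintegral_le_of_halves (measurableSet_le (by fun_prop) (by fun_prop))
        (upper_half_bound hα h) ?_
      simpa [neg_sq] using upper_half_bound (β := -β) hα h
    · exact upper_whole_bound hα hy h
  · refine lintegral_le_of_halves (measurableSet_le (by fun_prop) (by fun_prop))
      (lower_half_bound hα hy) ?_
    simpa [neg_sq] using lower_half_bound (β := -β) (κ := κ) hα hy

/-! ### The random walk and its exit from `(a, b)` -/

instance isProbabilityMeasure_iidLaw (P : Measure ℝ) [IsProbabilityMeasure P] :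
    IsProbabilityMeasure (iidLaw P) := by
  unfold iidLaw; infer_instance

/-- Freezing lemma: a coordinate is independent of the previous ones. -/
lemma lintegral_iidLaw_freeze (P : Measure ℝ) [IsProbabilityMeasure P] (n : ℕ)
    {F : (ℕ → ℝ) → ℝ → ℝ≥0∞} (hF : Measurable (Function.uncurry F))
    (hdep : ∀ ω ω' : ℕ → ℝ, (∀ i < n, ω i = ω' i) → F ω = F ω') :
    ∫⁻ ω, F ω (ω n) ∂(iidLaw P) = ∫⁻ ω, ∫⁻ x, F ω x ∂P ∂(iidLaw P) := by
  -- Padding the first `n` coordinates with zeros leaves `F` unchanged, so `F` factors through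
  -- `res`, which is independent of coordinate `n`.
  let res : (ℕ → ℝ) → (Finset.range n → ℝ) := fun ω i => ω i
  let ext : (Finset.range n → ℝ) → (ℕ → ℝ) :=
    fun z i => if h : i ∈ Finset.range n then z ⟨i, h⟩ else 0
  have hres : Measurable res := by fun_prop
  have hext : Measurable ext := by
    refine measurable_pi_lambda _ fun i => ?_
    by_cases h : i ∈ Finset.range n
    · simp only [ext, dif_pos h]
      exact measurable_pi_apply _
    · simp only [ext, dif_neg h]
      exact measurable_const
  have hFe : ∀ ω, F (ext (res ω)) = F ω := fun ω =>
    hdep _ _ fun i hi => by simp [ext, res, hi]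
  have hind : iIndepFun (fun (i : ℕ) (ω : ℕ → ℝ) => ω i) (iidLaw P) :=
    iIndepFun_infinitePi (X := fun _ x => x) fun _ => measurable_id
  have hpair : IndepFun res (fun ω => ω n) (iidLaw P) :=
    (hind.indepFun_finset (Finset.range n) {n} (by simp) (fun i => measurable_pi_apply i)).comp
      (φ := id) (ψ := fun z : (({n} : Finset ℕ) → ℝ) => z ⟨n, by simp⟩)
      measurable_id (measurable_pi_apply _)
  have hlaw : (iidLaw P).map (fun ω => ω n) = P := Measure.infinitePi_map_eval _ n
  have hmap := (indepFun_iff_map_prod_eq_prod_map_map hres.aemeasurable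
    (measurable_pi_apply n).aemeasurable).1 hpair
  rw [hlaw] at hmap
  have hG : Measurable fun p : (Finset.range n → ℝ) × ℝ => F (ext p.1) p.2 :=
    hF.comp ((hext.comp measurable_fst).prodMk measurable_snd)
  calc ∫⁻ ω, F ω (ω n) ∂(iidLaw P)
      = ∫⁻ ω, (fun p : (Finset.range n → ℝ) × ℝ => F (ext p.1) p.2) (res ω, ω n) ∂(iidLaw P) := by
        simp only [hFe]
    _ = ∫⁻ p, F (ext p.1) p.2 ∂(((iidLaw P).map res).prod P) := by
        rw [← hmap, lintegral_map hG (hres.prodMk (measurable_pi_apply n))]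
    _ = ∫⁻ z, ∫⁻ x, F (ext z) x ∂P ∂((iidLaw P).map res) := lintegral_prod _ hG.aemeasurable
    _ = ∫⁻ ω, ∫⁻ x, F ω x ∂P ∂(iidLaw P) := by
        rw [lintegral_map hG.lintegral_prod_right' hres]
        simp only [hFe]

variable {Y : ℝ → ℝ} {a b : ℝ} {B : Set ℝ} {n : ℕ}

lemma measurable_walk (hY : Measurable Y) (k : ℕ) : Measurable (walk Y k) := by
  unfold walk; fun_prop

lemma walk_succ (k : ℕ) (ω : ℕ → ℝ) : walk Y (k + 1) ω = walk Y k ω + Y (ω k) :=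
  Finset.sum_range_succ _ _

lemma walk_congr {k : ℕ} {ω ω' : ℕ → ℝ} (h : ∀ i < k, ω i = ω' i) : walk Y k ω = walk Y k ω' :=
  Finset.sum_congr rfl fun i hi => by rw [h i (Finset.mem_range.1 hi)]

/-- The walk stays in `(a, b)` at the times `1, …, n`. -/
def stays (Y : ℝ → ℝ) (a b : ℝ) (n : ℕ) : Set (ℕ → ℝ) :=
  {ω | ∀ j, 1 ≤ j → j ≤ n → walk Y j ω ∈ Set.Ioo a b}

/-- The walk leaves `(a, b)` at time `n + 1`, into the set `B`. -/
def exitsAt (Y : ℝ → ℝ) (a b : ℝ) (B : Set ℝ) (n : ℕ) : Set (ℕ → ℝ) :=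
  stays Y a b n ∩ {ω | walk Y (n + 1) ω ∈ B}

lemma measurableSet_stays (hY : Measurable Y) : MeasurableSet (stays Y a b n) := by
  have : stays Y a b n = ⋂ j, ⋂ (_ : 1 ≤ j), ⋂ (_ : j ≤ n), walk Y j ⁻¹' Set.Ioo a b := by
    ext ω; simp [stays]
  rw [this]
  exact .iInter fun j => .iInter fun _ => .iInter fun _ => measurable_walk hY j measurableSet_Ioo

lemma measurableSet_exitsAt (hY : Measurable Y) (hB : MeasurableSet B) :
    MeasurableSet (exitsAt Y a b B n) :=
  (measurableSet_stays hY).inter (measurable_walk hY _ hB)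

lemma exitTime_of_mem_exitsAt (hB : B ⊆ (Set.Ioo a b)ᶜ) {ω : ℕ → ℝ}
    (h : ω ∈ exitsAt Y a b B n) : exitTime Y a b ω = ((n + 1 : ℕ) : WithTop ℕ) := by
  refine le_antisymm (hittingAfter_le_of_mem (i := n + 1) (by omega) (hB h.2)) ?_
  by_contra! hlt
  obtain ⟨j, hj, hjm⟩ := hittingAfter_lt_iff.1 hlt
  exact hjm (h.1 j hj.1 (Nat.lt_succ_iff.1 hj.2))

lemma exitValue_of_mem_exitsAt (hB : B ⊆ (Set.Ioo a b)ᶜ) {ω : ℕ → ℝ}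
    (h : ω ∈ exitsAt Y a b B n) : exitValue Y a b ω = walk Y (n + 1) ω := by
  rw [exitValue, stoppedValue, exitTime_of_mem_exitsAt hB h]
  rfl

lemma iUnion_exitsAt (hB : B ⊆ (Set.Ioo a b)ᶜ) :
    ⋃ n, exitsAt Y a b B n = {ω | exitTime Y a b ω ≠ ⊤ ∧ exitValue Y a b ω ∈ B} := by
  ext ω
  simp only [Set.mem_iUnion, Set.mem_ofPred_eq]
  constructor
  · rintro ⟨n, hn⟩
    rw [exitTime_of_mem_exitsAt hB hn, exitValue_of_mem_exitsAt hB hn]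
    exact ⟨WithTop.coe_ne_top, hn.2⟩
  · rintro ⟨ht, hv⟩
    obtain ⟨k, hk⟩ := WithTop.ne_top_iff_exists.1 ht
    have h1 : ((1 : ℕ) : WithTop ℕ) ≤ exitTime Y a b ω := le_hittingAfter ω
    rw [← hk] at h1
    replace h1 : 1 ≤ k := WithTop.coe_le_coe.1 h1
    obtain ⟨n, rfl⟩ := Nat.exists_eq_add_of_le' h1
    refine ⟨n, fun j hj hjn => ?_, ?_⟩
    · by_contra hmem
      have hlt : (j : WithTop ℕ) < exitTime Y a b ω := by
        rw [← hk]; exact WithTop.coe_lt_coe.2 (Nat.lt_succ_of_le hjn)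
      exact notMem_of_lt_hittingAfter hlt hj hmem
    · rw [exitValue, stoppedValue, ← hk] at hv
      exact hv

lemma disjoint_exitsAt (hB : B ⊆ (Set.Ioo a b)ᶜ) :
    Pairwise (Function.onFun Disjoint (exitsAt Y a b B)) := by
  intro n m hnm
  refine Set.disjoint_left.2 fun ω h h' => hnm ?_
  have := (exitTime_of_mem_exitsAt hB h).symm.trans (exitTime_of_mem_exitsAt hB h')
  exact Nat.succ_injective (WithTop.coe_injective this)

/-- On each of the countably many pieces `exitsAt` the exit value is the walk at a fixed time. -/
lemma aestronglyMeasurable_exitValue (hY : Measurable Y) (hB : MeasurableSet B)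
    (hBC : B ⊆ (Set.Ioo a b)ᶜ) (P : Measure ℝ) :
    AEStronglyMeasurable (exitValue Y a b)
      ((iidLaw P).restrict {ω | exitTime Y a b ω ≠ ⊤ ∧ exitValue Y a b ω ∈ B}) := by
  rw [← iUnion_exitsAt hBC, aestronglyMeasurable_iUnion_iff]
  refine fun n => (measurable_walk hY (n + 1)).aestronglyMeasurable.congr ?_
  refine (ae_restrict_iff' (measurableSet_exitsAt hY hB)).2 (Eventually.of_forall fun ω hω => ?_)
  exact (exitValue_of_mem_exitsAt hBC hω).symm

variable {P : Measure ℝ} [IsProbabilityMeasure P]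

/-- Conditions on the first `n` observations: they determine `stays` and the state before the last
step, which is then a fresh draw from `P`. -/
lemma lintegral_exitsAt (hY : Measurable Y) (hB : MeasurableSet B) {h : ℝ → ℝ≥0∞}
    (hh : Measurable h) :
    ∫⁻ ω in exitsAt Y a b B n, h (walk Y (n + 1) ω) ∂(iidLaw P) =
      ∫⁻ ω in stays Y a b n, ∫⁻ x in {x | walk Y n ω + Y x ∈ B}, h (walk Y n ω + Y x) ∂P
        ∂(iidLaw P) := by
  set F : (ℕ → ℝ) → ℝ → ℝ≥0∞ := fun ω x =>
    (stays Y a b n).indicator (fun ω => B.indicator h (walk Y n ω + Y x)) ω with hF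
  have hm : Measurable fun p : (ℕ → ℝ) × ℝ => walk Y n p.1 + Y p.2 :=
    ((measurable_walk hY n).comp measurable_fst).add (hY.comp measurable_snd)
  have hFm : Measurable (Function.uncurry F) := by
    have : Function.uncurry F = (Prod.fst ⁻¹' stays Y a b n).indicator
        (fun p : (ℕ → ℝ) × ℝ => B.indicator h (walk Y n p.1 + Y p.2)) := by
      ext ⟨ω, x⟩; rfl
    rw [this]
    exact ((hh.indicator hB).comp hm).indicator (measurable_fst (measurableSet_stays hY))
  have hdep : ∀ ω ω' : ℕ → ℝ, (∀ i < n, ω i = ω' i) → F ω = F ω' := by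
    intro ω ω' hω
    have h1 : ω ∈ stays Y a b n ↔ ω' ∈ stays Y a b n :=
      forall_congr' fun j => forall_congr' fun _ => forall_congr' fun hj => by
        rw [walk_congr (ω := ω) (ω' := ω') fun i hi => hω i (hi.trans_le hj)]
    ext x
    by_cases hs : ω ∈ stays Y a b n
    · simp only [hF, Set.indicator_of_mem hs, Set.indicator_of_mem (h1.1 hs), walk_congr hω]
    · simp only [hF, Set.indicator_of_notMem hs, Set.indicator_of_notMem (mt h1.2 hs)]
  have key := lintegral_iidLaw_freeze P n hFm hdep
  rw [← lintegral_indicator (measurableSet_exitsAt hY hB),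
    ← lintegral_indicator (measurableSet_stays hY)]
  convert key using 3 with ω ω
  · by_cases hs : ω ∈ stays Y a b n
    · simp only [hF, Set.indicator_of_mem hs, ← walk_succ]
      by_cases hB' : walk Y (n + 1) ω ∈ B
      · rw [Set.indicator_of_mem hB', Set.indicator_of_mem (show ω ∈ exitsAt Y a b B n from
          ⟨hs, hB'⟩)]
      · rw [Set.indicator_of_notMem hB', Set.indicator_of_notMem fun h : ω ∈ exitsAt Y a b B n =>
          hB' h.2]
    · rw [Set.indicator_of_notMem fun h : ω ∈ exitsAt Y a b B n => hs h.1]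
      simp only [hF, Set.indicator_of_notMem hs]
  · by_cases hω : ω ∈ stays Y a b n
    · simp only [hF, Set.indicator_of_mem hω]
      rw [← lintegral_indicator (s := {x | walk Y n ω + Y x ∈ B})
        (hB.preimage (hY.const_add _))]
      rfl
    · simp [hF, Set.indicator_of_notMem hω]

/-- A bound for one step from every state carries over to the exit position. -/
lemma lintegral_exit_le (hY : Measurable Y) (hB : MeasurableSet B) (hBC : B ⊆ (Set.Ioo a b)ᶜ)
    {f : ℝ → ℝ≥0∞} (hf : Measurable f) {c : ℝ≥0∞}
    (hstep : ∀ u, u = 0 ∨ u ∈ Set.Ioo a b →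
      ∫⁻ x in {x | u + Y x ∈ B}, f (u + Y x) ∂P ≤ c * P {x | u + Y x ∈ B}) :
    ∫⁻ ω in {ω | exitTime Y a b ω ≠ ⊤ ∧ exitValue Y a b ω ∈ B},
        f (exitValue Y a b ω) ∂(iidLaw P)
      ≤ c * iidLaw P {ω | exitTime Y a b ω ≠ ⊤ ∧ exitValue Y a b ω ∈ B} := by
  rw [← iUnion_exitsAt hBC,
    lintegral_iUnion (fun n => measurableSet_exitsAt hY hB) (disjoint_exitsAt hBC),
    measure_iUnion (disjoint_exitsAt hBC) (fun n => measurableSet_exitsAt hY hB),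
    ← ENNReal.tsum_mul_left]
  refine ENNReal.tsum_le_tsum fun n => ?_
  calc ∫⁻ ω in exitsAt Y a b B n, f (exitValue Y a b ω) ∂(iidLaw P)
      = ∫⁻ ω in exitsAt Y a b B n, f (walk Y (n + 1) ω) ∂(iidLaw P) :=
        setLIntegral_congr_fun (measurableSet_exitsAt hY hB) fun ω hω => by
          rw [exitValue_of_mem_exitsAt hBC hω]
    _ = ∫⁻ ω in stays Y a b n, ∫⁻ x in {x | walk Y n ω + Y x ∈ B}, f (walk Y n ω + Y x) ∂P
        ∂(iidLaw P) := lintegral_exitsAt hY hB hf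
    _ ≤ ∫⁻ ω in stays Y a b n, ∫⁻ _ in {x | walk Y n ω + Y x ∈ B}, c ∂P ∂(iidLaw P) := by
        refine setLIntegral_mono' (measurableSet_stays hY) fun ω hω => ?_
        rw [setLIntegral_const]
        refine hstep _ ?_
        rcases Nat.eq_zero_or_pos n with rfl | hn
        · left; simp [walk]
        · exact Or.inr (hω n hn le_rfl)
    _ = c * iidLaw P (exitsAt Y a b B n) := by
        -- The same identity with constant `h`, read backwards, reassembles the probability.
        rw [← lintegral_exitsAt (h := fun _ => c) hY hB measurable_const, setLIntegral_const]

lemma measurableSet_exit (hY : Measurable Y) (hB : MeasurableSet B) (hBC : B ⊆ (Set.Ioo a b)ᶜ) :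
    MeasurableSet {ω | exitTime Y a b ω ≠ ⊤ ∧ exitValue Y a b ω ∈ B} := by
  rw [← iUnion_exitsAt hBC]
  exact .iUnion fun n => measurableSet_exitsAt hY hB

lemma Ici_subset_compl : Set.Ici b ⊆ (Set.Ioo a b)ᶜ := fun _ hx h => not_lt.2 hx h.2

lemma Iic_subset_compl : Set.Iic a ⊆ (Set.Ioo a b)ᶜ := fun _ hx h => not_lt.2 hx h.1

lemma lintegral_exitAbove_le (hY : Measurable Y) {ε : ℝ} (h : OvershootBound P Y ε) (hb : 0 < b) :
    ∫⁻ ω in exitAbove Y a b, ENNReal.ofReal (exitValue Y a b ω - b) ∂(iidLaw P)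
      ≤ ENNReal.ofReal ε * iidLaw P (exitAbove Y a b) := by
  refine lintegral_exit_le (f := fun s => ENNReal.ofReal (s - b)) hY measurableSet_Ici
    Ici_subset_compl (by fun_prop) fun u hu => ?_
  -- The start `u = 0` is a separate case because `0 ∉ (a, b)` when `a = 0`.
  have hu : 0 ≤ b - u := by
    rcases hu with rfl | hu
    · simpa using hb.le
    · exact sub_nonneg.2 hu.2.le
  have e : {x | u + Y x ∈ Set.Ici b} = {x | b - u ≤ Y x} := by
    ext x; simp only [Set.mem_ofPred_eq, Set.mem_Ici]; constructor <;> intro <;> linarith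
  rw [e]
  convert h.1 _ hu using 4
  ring

lemma lintegral_exitBelow_le (hY : Measurable Y) {ε : ℝ} (h : OvershootBound P Y ε) (ha : a ≤ 0) :
    ∫⁻ ω in exitBelow Y a b, ENNReal.ofReal (a - exitValue Y a b ω) ∂(iidLaw P)
      ≤ ENNReal.ofReal ε * iidLaw P (exitBelow Y a b) := by
  refine lintegral_exit_le (f := fun s => ENNReal.ofReal (a - s)) hY measurableSet_Iic
    Iic_subset_compl (by fun_prop) fun u hu => ?_
  have hu : a - u ≤ 0 := by
    rcases hu with rfl | hu
    · simpa using ha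
    · exact sub_nonpos.2 hu.1.le
  have e : {x | u + Y x ∈ Set.Iic a} = {x | Y x ≤ a - u} := by
    ext x; simp only [Set.mem_ofPred_eq, Set.mem_Iic]; constructor <;> intro <;> linarith
  rw [e]
  convert h.2 _ hu using 4
  ring

lemma iidLaw_exitAbove_ne_zero (hY : Measurable Y) (h : P {x | b ≤ Y x} ≠ 0) :
    iidLaw P (exitAbove Y a b) ≠ 0 := by
  have hlaw : (iidLaw P).map (fun ω => ω 0) = P := Measure.infinitePi_map_eval _ 0
  rw [← hlaw, Measure.map_apply (measurable_pi_apply 0)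
    (measurableSet_le measurable_const hY)] at h
  refine fun h0 => h (measure_mono_null (fun ω hω => ?_) h0)
  have hmem : ω ∈ ⋃ n, exitsAt Y a b (Set.Ici b) n := by
    refine Set.mem_iUnion.2 ⟨0, fun j h1 h2 => by omega, ?_⟩
    have hω : b ≤ Y (ω 0) := hω
    simpa [walk] using hω
  rw [iUnion_exitsAt Ici_subset_compl] at hmem
  exact hmem

/-- A single step need not reach `a`, as `Y` may be bounded below. Sufficiently many independent
steps of at most `-δ` do reach it, and they keep the walk below `b` meanwhile. -/
lemma iidLaw_exitBelow_ne_zero (hY : Measurable Y) (hb : 0 < b) {δ : ℝ} (hδ : 0 < δ)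
    (h : P {x | Y x ≤ -δ} ≠ 0) : iidLaw P (exitBelow Y a b) ≠ 0 := by
  obtain ⟨N, hN⟩ := exists_nat_gt (-a / δ)
  have hNa : -a < (N + 1) * δ := by
    have := (div_lt_iff₀ hδ).1 hN
    nlinarith
  have hpos : iidLaw P (Set.pi (Finset.range (N + 1)) fun _ => {x | Y x ≤ -δ}) ≠ 0 := by
    rw [iidLaw, Measure.infinitePi_pi _ (fun _ _ => measurableSet_le hY measurable_const)]
    simp [h]
  refine fun h0 => hpos (measure_mono_null (fun ω hω => ?_) h0)
  have hstep : ∀ i < N + 1, Y (ω i) ≤ -δ := fun i hi => hω i (by simpa using hi)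
  have hwalk : ∀ k ≤ N + 1, walk Y k ω ≤ -(k * δ) := by
    intro k hk
    calc walk Y k ω ≤ ∑ _j ∈ Finset.range k, -δ :=
          Finset.sum_le_sum fun i hi => hstep i (by have := Finset.mem_range.1 hi; omega)
      _ = _ := by simp
  have hNex : walk Y (N + 1) ω ∈ (Set.Ioo a b)ᶜ := fun hmem => by
    have := hwalk (N + 1) le_rfl
    push_cast at this
    linarith [hmem.1]
  have hle : exitTime Y a b ω ≤ ((N + 1 : ℕ) : WithTop ℕ) :=
    hittingAfter_le_of_mem (i := N + 1) (by omega) hNex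
  have hne : exitTime Y a b ω ≠ ⊤ := ne_top_of_le_ne_top WithTop.coe_ne_top hle
  have hmem : ω ∈ ⋃ n, exitsAt Y a b (Set.Ioo a b)ᶜ n := by
    rw [iUnion_exitsAt subset_rfl]
    exact ⟨hne, hittingAfter_mem_set_of_ne_top hne⟩
  obtain ⟨n, hn⟩ := Set.mem_iUnion.1 hmem
  have hT := exitTime_of_mem_exitsAt subset_rfl hn
  rw [hT] at hle
  replace hle : n + 1 ≤ N + 1 := WithTop.coe_le_coe.1 hle
  refine ⟨hne, ?_⟩
  rw [exitValue_of_mem_exitsAt subset_rfl hn]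
  by_contra! hlt
  refine hn.2 ⟨hlt, (hwalk _ hle).trans_lt ?_⟩
  have : 0 ≤ ((n + 1 : ℕ) : ℝ) * δ := by positivity
  linarith

/-! ### From integral bounds to conditional means and limits -/

lemma condMean_nonneg_le {Ω : Type*} [MeasurableSpace Ω] {P : Measure Ω} [IsFiniteMeasure P]
    {U : Ω → ℝ} {A : Set Ω} {ε : ℝ} (hA : MeasurableSet A) (hε : 0 ≤ ε)
    (hU : AEStronglyMeasurable U (P.restrict A)) (h0 : ∀ ω ∈ A, 0 ≤ U ω)
    (h : ∫⁻ ω in A, ENNReal.ofReal (U ω) ∂P ≤ ENNReal.ofReal ε * P A) :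
    0 ≤ condMean P U A ∧ condMean P U A ≤ ε := by
  have hae : 0 ≤ᵐ[ProbabilityTheory.cond P A] U :=
    Measure.ae_smul_measure
      ((ae_restrict_iff' hA).2 (Eventually.of_forall fun ω hω => h0 ω hω)) _
  refine ⟨integral_nonneg_of_ae hae, ?_⟩
  rw [condMean, integral_eq_lintegral_of_nonneg_ae hae (hU.smul_measure _)]
  refine ENNReal.toReal_le_of_le_ofReal hε ?_
  rw [ProbabilityTheory.cond, lintegral_smul_measure, smul_eq_mul]
  calc (P A)⁻¹ * ∫⁻ ω in A, ENNReal.ofReal (U ω) ∂P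
      ≤ (P A)⁻¹ * (ENNReal.ofReal ε * P A) := mul_le_mul_right h _
    _ = ENNReal.ofReal ε * ((P A)⁻¹ * P A) := by ring
    _ ≤ ENNReal.ofReal ε * 1 := mul_le_mul_right (ENNReal.inv_mul_le_one _) _
    _ = _ := mul_one _

lemma condMean_neg {Ω : Type*} [MeasurableSpace Ω] (P : Measure Ω) (U : Ω → ℝ) (A : Set Ω) :
    condMean P (fun ω => -U ω) A = -condMean P U A := integral_neg _

lemma integrableOn_of_lintegral_le {Ω : Type*} [MeasurableSpace Ω] {P : Measure Ω}
    [IsFiniteMeasure P] {U : Ω → ℝ} {A : Set Ω} {ε : ℝ} (hA : MeasurableSet A)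
    (hU : AEStronglyMeasurable U (P.restrict A)) (h0 : ∀ ω ∈ A, 0 ≤ U ω)
    (h : ∫⁻ ω in A, ENNReal.ofReal (U ω) ∂P ≤ ENNReal.ofReal ε * P A) :
    IntegrableOn U A P := by
  refine ⟨hU, (hasFiniteIntegral_iff_ofReal
    ((ae_restrict_iff' hA).2 (Eventually.of_forall fun ω hω => h0 ω hω))).2 ?_⟩
  exact h.trans_lt (ENNReal.mul_lt_top ENNReal.ofReal_lt_top (measure_lt_top _ _))

section Bound

variable {P : Measure ℝ} [IsProbabilityMeasure P] {Y : ℝ → ℝ} {ε a b y : ℝ}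

lemma condMean_excess (hY : Measurable Y) (hε : 0 ≤ ε) (h : OvershootBound P Y ε) (hy : 0 ≤ y) :
    0 ≤ condMean P (fun x => Y x - y) {x | y ≤ Y x} ∧
      condMean P (fun x => Y x - y) {x | y ≤ Y x} ≤ ε :=
  condMean_nonneg_le (measurableSet_le measurable_const hY) hε
    (hY.sub_const y).aestronglyMeasurable (fun _ hx => sub_nonneg.2 hx) (h.1 y hy)

lemma condMean_shortfall (hY : Measurable Y) (hε : 0 ≤ ε) (h : OvershootBound P Y ε)
    (hy : y ≤ 0) :
    -ε ≤ condMean P (fun x => Y x - y) {x | Y x ≤ y} ∧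
      condMean P (fun x => Y x - y) {x | Y x ≤ y} ≤ 0 := by
  have := condMean_nonneg_le (U := fun x => y - Y x) (measurableSet_le hY measurable_const) hε
    (hY.const_sub y).aestronglyMeasurable (fun _ hx => sub_nonneg.2 hx) (h.2 y hy)
  have e := condMean_neg P (fun x => y - Y x) {x | Y x ≤ y}
  simp only [neg_sub] at e
  rw [e]
  constructor <;> linarith

lemma exitAbove_spec (hY : Measurable Y) (hε : 0 ≤ ε) (h : OvershootBound P Y ε) (hb : 0 < b) :
    IntegrableOn (exitValue Y a b) (exitAbove Y a b) (iidLaw P) ∧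
    0 ≤ condMean (iidLaw P) (fun ω => exitValue Y a b ω - b) (exitAbove Y a b) ∧
      condMean (iidLaw P) (fun ω => exitValue Y a b ω - b) (exitAbove Y a b) ≤ ε := by
  have hA : MeasurableSet (exitAbove Y a b) :=
    measurableSet_exit hY measurableSet_Ici Ici_subset_compl
  have hm : AEStronglyMeasurable (exitValue Y a b) ((iidLaw P).restrict (exitAbove Y a b)) :=
    aestronglyMeasurable_exitValue hY measurableSet_Ici Ici_subset_compl P
  have hm' := hm.sub (aestronglyMeasurable_const (b := b))
  have h0 : ∀ ω ∈ exitAbove Y a b, 0 ≤ exitValue Y a b ω - b := fun ω hω => sub_nonneg.2 hω.2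
  have hle := lintegral_exitAbove_le (a := a) hY h hb
  refine ⟨?_, condMean_nonneg_le hA hε hm' h0 hle⟩
  have hi := (integrableOn_of_lintegral_le hA hm' h0 hle).add
    (integrable_const (μ := (iidLaw P).restrict (exitAbove Y a b)) b)
  exact hi.congr (Eventually.of_forall fun ω => by simp)

lemma exitBelow_spec (hY : Measurable Y) (hε : 0 ≤ ε) (h : OvershootBound P Y ε) (ha : a ≤ 0) :
    IntegrableOn (exitValue Y a b) (exitBelow Y a b) (iidLaw P) ∧
    -ε ≤ condMean (iidLaw P) (fun ω => exitValue Y a b ω - a) (exitBelow Y a b) ∧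
      condMean (iidLaw P) (fun ω => exitValue Y a b ω - a) (exitBelow Y a b) ≤ 0 := by
  have hA : MeasurableSet (exitBelow Y a b) :=
    measurableSet_exit hY measurableSet_Iic Iic_subset_compl
  have hm : AEStronglyMeasurable (exitValue Y a b) ((iidLaw P).restrict (exitBelow Y a b)) :=
    aestronglyMeasurable_exitValue hY measurableSet_Iic Iic_subset_compl P
  have hm' := (aestronglyMeasurable_const (b := a)).sub hm
  have h0 : ∀ ω ∈ exitBelow Y a b, 0 ≤ a - exitValue Y a b ω := fun ω hω => sub_nonneg.2 hω.2
  have hle := lintegral_exitBelow_le (b := b) hY h ha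
  refine ⟨?_, ?_⟩
  · have hi := (integrable_const (μ := (iidLaw P).restrict (exitBelow Y a b)) a).sub
      (integrableOn_of_lintegral_le hA hm' h0 hle)
    exact hi.congr (Eventually.of_forall fun ω => by simp)
  · have := condMean_nonneg_le hA hε hm' h0 hle
    have e := condMean_neg (iidLaw P) (fun ω => a - exitValue Y a b ω) (exitBelow Y a b)
    simp only [neg_sub] at e
    rw [e]
    change 0 ≤ condMean _ (fun ω => a - exitValue Y a b ω) _ ∧
      condMean _ (fun ω => a - exitValue Y a b ω) _ ≤ ε at this
    constructor <;> linarith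

end Bound

/-- A vanishing overshoot bound yields all the asymptotic statements. -/
theorem overshoots_vanish {P : ℝ → Measure ℝ} [∀ γ, IsProbabilityMeasure (P γ)]
    {Y : ℝ → ℝ → ℝ} {ε : ℝ → ℝ} (hY : ∀ γ, Measurable (Y γ))
    (hint : ∀ γ, Integrable (Y γ) (P γ)) (hε : ∀ γ, 0 ≤ ε γ) (hε0 : Tendsto ε atTop (𝓝 0))
    (hbound : ∀ γ, OvershootBound (P γ) (Y γ) (ε γ))
    (hup : ∀ γ, 0 < γ → ∀ y, P γ {x | y ≤ Y γ x} ≠ 0)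
    (hdown : ∀ γ, 0 < γ → ∃ δ > 0, P γ {x | Y γ x ≤ -δ} ≠ 0) :
    UpperCondition P Y ∧ LowerCondition P Y ∧ ∀ a b : ℝ, a ≤ 0 → 0 < b →
      UpperOvershootVanishes P Y a b ∧ LowerOvershootVanishes P Y a b := by
  have hεn : Tendsto (fun γ => -ε γ) atTop (𝓝 0) := by simpa using hε0.neg
  refine ⟨⟨fun γ hγ => ⟨hint γ, fun y _ => hup γ hγ y⟩, ?_⟩,
    ⟨fun γ hγ => ⟨hint γ, ?_⟩, ?_⟩, fun a b ha hb => ⟨⟨fun γ hγ => ⟨?_, ?_⟩, ?_⟩,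
    ⟨fun γ hγ => ⟨?_, ?_⟩, ?_⟩⟩⟩
  · refine tendsto_of_tendsto_of_tendsto_of_le_of_le tendsto_const_nhds
      ((continuous_coe_real_ereal.tendsto 0).comp hε0) (fun γ => ?_) (fun γ => ?_)
    -- The level `y = 0` alone shows that the supremum is nonnegative.
    · refine le_trans ?_ (le_iSup₂ (0 : ℝ) le_rfl)
      exact EReal.coe_nonneg.2 (condMean_excess (hY γ) (hε γ) (hbound γ) le_rfl).1
    · refine iSup₂_le fun y hy => ?_
      exact EReal.coe_le_coe_iff.2 (condMean_excess (hY γ) (hε γ) (hbound γ) hy).2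
  · obtain ⟨δ, hδ, h⟩ := hdown γ hγ
    exact fun h0 => h (measure_mono_null
      (fun x (hx : Y γ x ≤ -δ) => show Y γ x ≤ 0 by linarith) h0)
  · refine tendsto_of_tendsto_of_tendsto_of_le_of_le
      ((continuous_coe_real_ereal.tendsto 0).comp hεn) tendsto_const_nhds
      (fun γ => ?_) (fun γ => ?_)
    · refine le_iInf₂ fun y hy => ?_
      exact EReal.coe_le_coe_iff.2 (condMean_shortfall (hY γ) (hε γ) (hbound γ) hy).1
    · refine iInf₂_le_of_le (0 : ℝ) (le_refl (0 : ℝ)) ?_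
      exact EReal.coe_nonpos.2 (condMean_shortfall (hY γ) (hε γ) (hbound γ) le_rfl).2
  · exact iidLaw_exitAbove_ne_zero (hY γ) (hup γ hγ b)
  · exact (exitAbove_spec (hY γ) (hε γ) (hbound γ) hb).1
  · exact tendsto_of_tendsto_of_tendsto_of_le_of_le tendsto_const_nhds hε0
      (fun γ => (exitAbove_spec (hY γ) (hε γ) (hbound γ) hb).2.1)
      (fun γ => (exitAbove_spec (hY γ) (hε γ) (hbound γ) hb).2.2)
  · obtain ⟨δ, hδ, h⟩ := hdown γ hγ
    exact iidLaw_exitBelow_ne_zero (hY γ) hb hδ h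
  · exact (exitBelow_spec (hY γ) (hε γ) (hbound γ) ha).1
  · exact tendsto_of_tendsto_of_tendsto_of_le_of_le hεn tendsto_const_nhds
      (fun γ => (exitBelow_spec (hY γ) (hε γ) (hbound γ) ha).2.1)
      (fun γ => (exitBelow_spec (hY γ) (hε γ) (hbound γ) ha).2.2)

/-! ### The Gaussian log-likelihood ratio -/

lemma OvershootBound.of_map {P : Measure ℝ} {φ Y : ℝ → ℝ} {ε : ℝ} (hφ : Measurable φ)
    (hY : Measurable Y) (h : OvershootBound P (fun x => Y (φ x)) ε) :
    OvershootBound (P.map φ) Y ε := by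
  refine ⟨fun y hy => ?_, fun y hy => ?_⟩
  · have hm : MeasurableSet {x | y ≤ Y x} := measurableSet_le measurable_const hY
    rw [setLIntegral_map hm (by fun_prop) hφ, Measure.map_apply hφ hm]
    exact h.1 y hy
  · have hm : MeasurableSet {x | Y x ≤ y} := measurableSet_le hY measurable_const
    rw [setLIntegral_map hm (by fun_prop) hφ, Measure.map_apply hφ hm]
    exact h.2 y hy

lemma coe_postVar (s : ℝ) : (postVar s : ℝ) = 1 + s ^ 2 := rfl

lemma postVar_ne_zero (s : ℝ) : postVar s ≠ 0 := by
  rw [← NNReal.coe_ne_zero, coe_postVar]; positivity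

lemma gaussianLogLR_eq (m s x : ℝ) :
    gaussianLogLR m s x =
      -(Real.log (1 + s ^ 2) / 2) + x ^ 2 / 2 - (x - m) ^ 2 / (2 * (1 + s ^ 2)) := by
  have hv : (0 : ℝ) < 1 + s ^ 2 := by positivity
  have h1 : 0 < √(2 * Real.pi * (1 + s ^ 2)) := by positivity
  have h2 : 0 < √(2 * Real.pi) := by positivity
  rw [gaussianLogLR, logLR, Real.log_div (gaussianPDFReal_pos _ _ _ (postVar_ne_zero s)).ne'
    (gaussianPDFReal_pos _ _ _ one_ne_zero).ne', gaussianPDFReal, gaussianPDFReal, coe_postVar,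
    Real.log_mul (by positivity) (by positivity), Real.log_mul (by simp; positivity)
    (by positivity), Real.log_exp, Real.log_exp, Real.log_inv, Real.log_inv, Real.log_sqrt (by positivity),
    Real.log_sqrt (by simp; positivity), Real.log_mul (by positivity) hv.ne']
  simp
  ring

lemma continuous_gaussianLogLR (m s : ℝ) : Continuous (gaussianLogLR m s) := by
  have : gaussianLogLR m s = fun x => _ := funext (gaussianLogLR_eq m s)
  rw [this]; fun_prop

lemma gaussianLogLR_eq_quadratic (m s x : ℝ) :
    gaussianLogLR m s x = s ^ 2 / (2 * (1 + s ^ 2)) * x ^ 2 + m / (1 + s ^ 2) * x +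
      (-(Real.log (1 + s ^ 2) / 2) - m ^ 2 / (2 * (1 + s ^ 2))) := by
  rw [gaussianLogLR_eq]
  have hv : (0 : ℝ) < 1 + s ^ 2 := by positivity
  field_simp
  ring

/-- Brings the law `q_γ` back to the standard Gaussian; the leading coefficient remains nonnegative.
-/
lemma gaussianLogLR_standardized (m s z : ℝ) :
    gaussianLogLR m s (√(1 + s ^ 2) * z + m) = s ^ 2 / 2 * z ^ 2 + m * √(1 + s ^ 2) * z +
      (-(Real.log (1 + s ^ 2) / 2) + m ^ 2 / 2) := by
  have hv : (0 : ℝ) < 1 + s ^ 2 := by positivity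
  have h : √(1 + s ^ 2) ^ 2 = 1 + s ^ 2 := Real.sq_sqrt hv.le
  have h2 : (√(1 + s ^ 2) * z + m - m) ^ 2 / (2 * (1 + s ^ 2)) = z ^ 2 / 2 := by
    rw [add_sub_cancel_right, mul_pow, h]; field_simp
  rw [gaussianLogLR_eq, h2, add_sq, mul_pow, h]
  ring

lemma gaussianReal_eq_map (m s : ℝ) :
    gaussianReal m (postVar s) = (gaussianReal 0 1).map (fun z => √(1 + s ^ 2) * z + m) := by
  have h : (fun z => √(1 + s ^ 2) * z + m) = (fun x => x + m) ∘ fun z => √(1 + s ^ 2) * z := rfl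
  rw [h, ← Measure.map_map (by fun_prop) (by fun_prop), gaussianReal_map_const_mul,
    gaussianReal_map_add_const]
  congr 1
  · simp
  · ext
    simp [coe_postVar, Real.sq_sqrt (show (0 : ℝ) ≤ 1 + s ^ 2 by positivity)]

lemma exists_lt_quadratic {A B : ℝ} (K y : ℝ) (hA : 0 ≤ A) (h : A ≠ 0 ∨ B ≠ 0) :
    ∃ x : ℝ, y < A * x ^ 2 + B * x + K := by
  rcases hA.eq_or_lt with rfl | hA
  · have hB : B ≠ 0 := by simpa using h
    refine ⟨(y - K + 1) / B, ?_⟩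
    rw [mul_div_cancel₀ _ hB]; linarith
  -- With `t ≥ 1`, `A t² ≥ A t = A + |y| + |K|`, which exceeds `y - K`; the sign of the witness `±t`
  -- makes the linear term nonnegative.
  · set t := 1 + (|y| + |K|) / A with ht
    have h1 : 1 ≤ t := by rw [ht]; linarith [show 0 ≤ (|y| + |K|) / A by positivity]
    have h2 : A * t = A + (|y| + |K|) := by rw [ht]; field_simp
    have h3 : y < A * t ^ 2 + K := by
      have : A * t ≤ A * t ^ 2 := by nlinarith [mul_nonneg hA.le (by linarith : 0 ≤ t)]
      linarith [le_abs_self y, neg_abs_le K]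
    rcases le_total 0 B with hB | hB
    · exact ⟨t, by nlinarith⟩
    · exact ⟨-t, by nlinarith⟩

variable {m s : ℝ}

lemma exists_lt_gaussianLogLR (h : (m, s) ≠ (0, 0)) (y : ℝ) : ∃ x, y < gaussianLogLR m s x := by
  simp_rw [gaussianLogLR_eq_quadratic]
  have hv : (0 : ℝ) < 1 + s ^ 2 := by positivity
  refine exists_lt_quadratic _ y (by positivity) ?_
  by_contra! h'
  refine h (Prod.ext ?_ ?_)
  · simpa [hv.ne'] using h'.2
  · simpa [hv.ne'] using h'.1

/-- By continuity this makes `Y` bounded away from `0` on a nonempty open set, giving the downward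
steps needed to exit below. -/
lemma gaussianLogLR_zero_neg (h : (m, s) ≠ (0, 0)) : gaussianLogLR m s 0 < 0 := by
  have e := gaussianLogLR_eq_quadratic m s 0
  rw [zero_pow two_ne_zero, mul_zero, mul_zero, zero_add, zero_add] at e
  rw [e]
  have h1 : 0 ≤ Real.log (1 + s ^ 2) := Real.log_nonneg (by nlinarith [sq_nonneg s])
  have h2 : 0 ≤ m ^ 2 / (2 * (1 + s ^ 2)) := by positivity
  rcases eq_or_ne s 0 with rfl | hs
  · have hm : m ≠ 0 := fun hm => h (by simp [hm])
    have : 0 < m ^ 2 / (2 * (1 + (0 : ℝ) ^ 2)) := by positivity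
    exact sub_neg.2 ((neg_nonpos.2 (div_nonneg h1 zero_le_two)).trans_lt this)
  · have : 0 < Real.log (1 + s ^ 2) := Real.log_pos (by
      have := sq_pos_of_ne_zero hs; linarith)
    linarith

lemma measure_le_gaussianLogLR_ne_zero {P : Measure ℝ} (hP : volume ≪ P) (h : (m, s) ≠ (0, 0))
    (y : ℝ) : P {x | y ≤ gaussianLogLR m s x} ≠ 0 := by
  refine fun h0 => (isOpen_lt continuous_const (continuous_gaussianLogLR m s)).measure_ne_zero
    volume (exists_lt_gaussianLogLR h y) ?_
  exact measure_mono_null (fun x (hx : y < _) => hx.le) (hP h0)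

lemma measure_gaussianLogLR_le_ne_zero {P : Measure ℝ} (hP : volume ≪ P)
    (h : (m, s) ≠ (0, 0)) : ∃ δ > 0, P {x | gaussianLogLR m s x ≤ -δ} ≠ 0 := by
  have hneg := gaussianLogLR_zero_neg h
  refine ⟨-gaussianLogLR m s 0 / 2, by linarith, fun h0 => ?_⟩
  refine (isOpen_lt (continuous_gaussianLogLR m s)
    (continuous_const (y := gaussianLogLR m s 0 / 2))).measure_ne_zero
    volume ⟨0, show gaussianLogLR m s 0 < _ by linarith⟩ ?_
  refine measure_mono_null (fun x hx => ?_) (hP h0)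
  have hx : gaussianLogLR m s x < gaussianLogLR m s 0 / 2 := hx
  exact show gaussianLogLR m s x ≤ _ by linarith

end GaussianOvershoot

open GaussianOvershoot in
theorem mainTheorem8 (μ σ : ℝ → ℝ)
    (hne : ∀ γ : ℝ, 0 < γ → (μ γ, σ γ) ≠ (0, 0))
    (hμ : Filter.Tendsto μ Filter.atTop (nhds 0))
    (hσ : Filter.Tendsto σ Filter.atTop (nhds 0))
    (P : ℝ → MeasureTheory.Measure ℝ)
    (hP : (P = fun _ => ProbabilityTheory.gaussianReal 0 1) ∨
      (P = fun γ => ProbabilityTheory.gaussianReal (μ γ) (GaussianOvershoot.postVar (σ γ)))) :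
    GaussianOvershoot.UpperCondition P
        (fun γ => GaussianOvershoot.gaussianLogLR (μ γ) (σ γ)) ∧
    GaussianOvershoot.LowerCondition P
        (fun γ => GaussianOvershoot.gaussianLogLR (μ γ) (σ γ)) ∧
    ∀ a b : ℝ, a ≤ 0 → 0 < b →
      GaussianOvershoot.UpperOvershootVanishes P
          (fun γ => GaussianOvershoot.gaussianLogLR (μ γ) (σ γ)) a b ∧
      GaussianOvershoot.LowerOvershootVanishes P
          (fun γ => GaussianOvershoot.gaussianLogLR (μ γ) (σ γ)) a b := by
  have hY : ∀ γ, Measurable (gaussianLogLR (μ γ) (σ γ)) := fun γ =>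
    (continuous_gaussianLogLR _ _).measurable
  -- Both error bounds are continuous functions of `(μ, σ)` that vanish at the origin.
  have hlim : ∀ f : ℝ × ℝ → ℝ, Continuous f → f (0, 0) = 0 →
      Tendsto (fun γ => f (μ γ, σ γ)) atTop (𝓝 0) := fun f hf h0 => by
    simpa [h0, Function.comp_def] using (hf.tendsto (0, 0)).comp (hμ.prodMk_nhds hσ)
  have hpos : ∀ s : ℝ, 1 + s ^ 2 ≠ 0 := fun s => by positivity
  have hpos2 : ∀ s : ℝ, 2 * (1 + s ^ 2) ≠ 0 := fun s => by positivity
  rcases hP with rfl | rfl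
  · have e : ∀ γ, gaussianLogLR (μ γ) (σ γ) = fun x => _ := fun γ =>
      funext (gaussianLogLR_eq_quadratic (μ γ) (σ γ))
    have hac : volume ≪ gaussianReal 0 1 := gaussianReal_absolutelyContinuous' 0 one_ne_zero
    refine overshoots_vanish hY (fun γ => ?_) (fun γ => ?_) ?_
      (fun γ => (e γ) ▸ overshootBound_quadratic (by positivity))
      (fun γ hγ => measure_le_gaussianLogLR_ne_zero hac (hne γ hγ))
      (fun γ hγ => measure_gaussianLogLR_le_ne_zero hac (hne γ hγ))
    · rw [e γ]; exact integrable_quadratic_stdGaussian _ _ _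
    · positivity
    · refine hlim (fun p => 2 * (p.2 ^ 2 / (2 * (1 + p.2 ^ 2)) + |p.1 / (1 + p.2 ^ 2)| +
        |-(Real.log (1 + p.2 ^ 2) / 2) - p.1 ^ 2 / (2 * (1 + p.2 ^ 2))|)) ?_ (by simp)
      fun_prop (disch := intro x; first | exact hpos _ | exact hpos2 _)
  · have hb : ∀ γ, OvershootBound (gaussianReal (μ γ) (postVar (σ γ)))
        (gaussianLogLR (μ γ) (σ γ)) (2 * ((σ γ) ^ 2 / 2 + |μ γ * √(1 + (σ γ) ^ 2)| +
          |-(Real.log (1 + (σ γ) ^ 2) / 2) + (μ γ) ^ 2 / 2|)) := fun γ => by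
      rw [gaussianReal_eq_map]
      refine .of_map (by fun_prop) (hY γ) ?_
      simp_rw [gaussianLogLR_standardized]
      exact overshootBound_quadratic (by positivity)
    have hac : ∀ γ, volume ≪ gaussianReal (μ γ) (postVar (σ γ)) := fun γ =>
      gaussianReal_absolutelyContinuous' _ (postVar_ne_zero _)
    refine overshoots_vanish hY (fun γ => ?_) (fun γ => ?_) ?_ hb
      (fun γ hγ => measure_le_gaussianLogLR_ne_zero (hac γ) (hne γ hγ))
      (fun γ hγ => measure_gaussianLogLR_le_ne_zero (hac γ) (hne γ hγ))
    · rw [gaussianReal_eq_map, integrable_map_measure (hY γ).aestronglyMeasurable (by fun_prop)]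
      simp only [Function.comp_def, gaussianLogLR_standardized]
      exact integrable_quadratic_stdGaussian _ _ _
    · positivity
    · refine hlim (fun p => 2 * (p.2 ^ 2 / 2 + |p.1 * √(1 + p.2 ^ 2)| +
        |-(Real.log (1 + p.2 ^ 2) / 2) + p.1 ^ 2 / 2|)) ?_ (by simp)
      fun_prop (disch := intro x; first | exact hpos _ | exact hpos2 _)
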